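/- Let $I$ be a directed preordered set, and let $(X_i)_{i\in I}$, $(f_{ij}\colon X_j\to X_i)_{i\le j}$ be a projective (inverse) system of nonempty compact Hausdorff spaces and continuous maps, i.e. $f_{ii}=\mathrm{id}$ and $f_{ij}\circ f_{jk}=f_{ik}$ for $i\le j\le k$. Let $\varprojlim X_i=\{(x_i)\in\prod_i X_i : f_{ij}(x_j)=x_i \text{ for all } i\le j\}$ carry the topology induced from the product, and let $X$ be a topological space homotopy equivalent to $\varprojlim X_i$. For a topological space $Z$, let $C(Z)$ denote the ring of continuous functions $Z\to\mathbb{C}$ with pointwise operations. A commutative unital ring $R$ is called projective free if every finitely generated projective $R$-module is free, and Hermite if every finitely generated stably free $R$-module is free, where an $R$-module $M$ is stably free if $M\oplus R^k$ is free for some integer $k\ge 0$. Then: 1. if $C(X_i)$ is projective free for every $i\in I$, then $C(X)$ is projective free; 2. if $C(X_i)$ is Hermite for every $i\in I$, then $C(X)$ is Hermite. -/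

import Mathlib

universe u

/-- A commutative ring is projective free if every finitely generated projective module is free.
(A finitely generated module over `R : Type u` is isomorphic to one living in `Type u`.) -/
def IsProjectiveFree (R : Type u) [CommRing R] : Prop :=
  ∀ (M : Type u) [AddCommGroup M] [Module R M],
    Module.Finite R M → Module.Projective R M → Module.Free R M

/-- A commutative ring is Hermite if every finitely generated stably free module is free. -/
def IsHermite (R : Type u) [CommRing R] : Prop :=
  ∀ (M : Type u) [AddCommGroup M] [Module R M],
    Module.Finite R M → Module.IsStablyFree R M → Module.Free R M

/-- The projective limit of a system of topological spaces and continuous bonding maps: the space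
of compatible families, with the subspace topology of the product topology. -/
abbrev ProjLim {ι : Type*} [Preorder ι] {Y : ι → Type*} [∀ i, TopologicalSpace (Y i)]
    (f : ∀ ⦃i j : ι⦄, i ≤ j → C(Y j, Y i)) : Type _ :=
  {y : ∀ i, Y i // ∀ ⦃i j : ι⦄ (h : i ≤ j), f h (y j) = y i}

/-! Both properties are statements about matrices: every idempotent `E` (projective free), or every
`1 - A * B` with `B * A = 1` (Hermite), splits in the sense of `MatrixSplits`. Splittings are pushed
forward by ring homomorphisms, so it suffices to relate a given matrix to one coming from some `Y
i`.

Homotopy: a homotopy turns an idempotent matrix into a path of idempotents, whose ends are conjugate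
over any base (`exists_intertwiner_of_idempotent_path`). So `X` may be replaced by the limit.

Limit: by Stone–Weierstrass a matrix over the limit is close to one pulled back from some `Y i`. The
latter satisfies the required identity only approximately, and only on the image of the limit in `Y
i`; but the approximate condition is open, so compactness makes it hold on all of some `Y j`
(`exists_forall_mem_of_isOpen`). There it is corrected to an exact identity: by iteration for
idempotents (`exists_idempotent_near`), by dividing by an invertible `B * A` for one-sided inverses.
Closeness keeps the module unchanged up to isomorphism. -/

/-! ### Idempotent matrices and projective modules -/

/-- A square matrix `E` splits if it factors as `A * B` with `B * A = 1`; equivalently, `E` is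
idempotent and its range is a free module. -/
def MatrixSplits {R : Type*} [CommRing R] {n : Type*} [Fintype n] (E : Matrix n n R) : Prop :=
  ∃ (r : ℕ) (A : Matrix n (Fin r) R) (B : Matrix (Fin r) n R), A * B = E ∧ B * A = 1

theorem MatrixSplits.map {R S : Type*} [CommRing R] [CommRing S] {n : Type*} [Fintype n]
    {E : Matrix n n R} (h : MatrixSplits E) (φ : R →+* S) : MatrixSplits (E.map φ) := by
  obtain ⟨r, A, B, h₁, h₂⟩ := h
  refine ⟨r, A.map φ, B.map φ, ?_, ?_⟩
  · rw [← Matrix.map_mul, h₁]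
  · rw [← Matrix.map_mul, h₂, Matrix.map_one _ (map_zero φ) (map_one φ)]

theorem MatrixSplits.of_intertwine {R : Type*} [CommRing R] {n : Type*} [Fintype n]
    [DecidableEq n] {E F T : Matrix n n R} (h : MatrixSplits E) (hT : IsUnit T.det)
    (hTE : T * E = F * T) : MatrixSplits F := by
  obtain ⟨r, A, B, h₁, h₂⟩ := h
  refine ⟨r, T * A, B * T⁻¹, ?_, ?_⟩
  · calc T * A * (B * T⁻¹) = T * (A * B) * T⁻¹ := by simp only [Matrix.mul_assoc]
      _ = F := by rw [h₁, hTE, Matrix.mul_nonsing_inv_cancel_right _ _ hT]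
  · rw [Matrix.mul_assoc, Matrix.nonsing_inv_mul_cancel_left _ _ hT, h₂]

section Modules

variable {R : Type u} [CommRing R]

theorem exists_equiv_fin_of_free (M : Type*) [AddCommGroup M] [Module R M] [Module.Finite R M]
    [Module.Free R M] : ∃ r : ℕ, Nonempty (M ≃ₗ[R] (Fin r → R)) := by
  let b := Module.Free.chooseBasis R M
  let e := Fintype.equivFin (Module.Free.ChooseBasisIndex R M)
  exact ⟨_, ⟨(b.reindex e).equivFun⟩⟩

/-- If `f : Rⁿ → M` is split by `g` and the matrix of the projection `g ∘ f` splits, then `M` is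
free. -/
theorem free_of_matrixSplits {M : Type*} [AddCommGroup M] [Module R M] {n : ℕ}
    (f : (Fin n → R) →ₗ[R] M) (g : M →ₗ[R] (Fin n → R)) (hfg : f ∘ₗ g = LinearMap.id)
    (h : MatrixSplits (LinearMap.toMatrix' (g ∘ₗ f))) : Module.Free R M := by
  obtain ⟨r, A, B, h₁, h₂⟩ := h
  have h₁' : Matrix.toLin' A ∘ₗ Matrix.toLin' B = g ∘ₗ f := by
    rw [← Matrix.toLin'_mul, h₁, Matrix.toLin'_toMatrix']
  have h₂' : Matrix.toLin' B ∘ₗ Matrix.toLin' A = LinearMap.id := by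
    rw [← Matrix.toLin'_mul, h₂, Matrix.toLin'_one]
  have hfg' (x : M) : f (g x) = x := LinearMap.congr_fun hfg x
  have h₁'' (x) : Matrix.toLin' A (Matrix.toLin' B x) = g (f x) := LinearMap.congr_fun h₁' x
  have h₂'' (x) : Matrix.toLin' B (Matrix.toLin' A x) = x := LinearMap.congr_fun h₂' x
  refine Module.Free.of_equiv (LinearEquiv.ofLinearMap (f ∘ₗ Matrix.toLin' A)
    (Matrix.toLin' B ∘ₗ g) ?_ ?_)
  · refine LinearMap.ext fun x => ?_
    simp only [LinearMap.comp_apply, h₁'', hfg', LinearMap.id_apply]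
  · refine LinearMap.ext fun x => ?_
    simp only [LinearMap.comp_apply, LinearMap.id_apply]
    rw [← h₁'', h₂'', h₂'']

theorem matrixSplits_of_free_range {n : ℕ} {E : Matrix (Fin n) (Fin n) R} (hE : E * E = E)
    (h : Module.Free R (LinearMap.range (Matrix.toLin' E))) : MatrixSplits E := by
  obtain ⟨r, ⟨e⟩⟩ := exists_equiv_fin_of_free (R := R) (LinearMap.range (Matrix.toLin' E))
  have hE' (x) : Matrix.toLin' E (Matrix.toLin' E x) = Matrix.toLin' E x := by
    rw [← LinearMap.comp_apply, ← Matrix.toLin'_mul, hE]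
  refine ⟨r, LinearMap.toMatrix' (Submodule.subtype _ ∘ₗ e.symm.toLinearMap),
    LinearMap.toMatrix' (e.toLinearMap ∘ₗ (Matrix.toLin' E).rangeRestrict), ?_, ?_⟩
  · rw [← LinearMap.toMatrix'_comp]
    apply Matrix.toLin'.injective
    rw [Matrix.toLin'_toMatrix']
    refine LinearMap.ext fun x => ?_
    simp
  · rw [← LinearMap.toMatrix'_comp, ← LinearMap.toMatrix'_id]
    congr 1
    refine LinearMap.ext fun x => ?_
    have : (Matrix.toLin' E).rangeRestrict (e.symm x : Fin n → R) = e.symm x := by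
      obtain ⟨y, hy⟩ := (e.symm x).2
      apply Subtype.ext
      change Matrix.toLin' E (e.symm x : Fin n → R) = e.symm x
      rw [← hy, hE']
    simp only [LinearMap.comp_apply, LinearEquiv.coe_coe, Submodule.subtype_apply, this,
      LinearEquiv.apply_symm_apply, LinearMap.id_apply]

theorem isProjectiveFree_iff : IsProjectiveFree R ↔
    ∀ (n : ℕ) (E : Matrix (Fin n) (Fin n) R), E * E = E → MatrixSplits E := by
  constructor
  · intro h n E hE
    refine matrixSplits_of_free_range hE (h _ inferInstance ?_)
    refine Module.Projective.of_split (Submodule.subtype _) (Matrix.toLin' E).rangeRestrict ?_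
    refine LinearMap.ext fun x => Subtype.ext ?_
    obtain ⟨y, hy⟩ := x.2
    change Matrix.toLin' E (x : Fin n → R) = x
    rw [← hy, ← LinearMap.comp_apply, ← Matrix.toLin'_mul, hE]
  · intro h M _ _ _ _
    obtain ⟨n, f, g, -, -, hfg⟩ := Module.Finite.exists_comp_eq_id_of_projective R M
    refine free_of_matrixSplits f g hfg (h n _ ?_)
    rw [← LinearMap.toMatrix'_comp]
    congr 1
    refine LinearMap.ext fun x => ?_
    have := LinearMap.congr_fun hfg (f x)
    simp only [LinearMap.comp_apply, LinearMap.id_apply] at this ⊢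
    rw [this]

theorem one_sub_mul_idempotent {n k : ℕ} {A : Matrix (Fin n) (Fin k) R}
    {B : Matrix (Fin k) (Fin n) R} (h : B * A = 1) : (1 - A * B) * (1 - A * B) = 1 - A * B := by
  have : A * B * (A * B) = A * B := by
    rw [Matrix.mul_assoc, ← Matrix.mul_assoc B, h, Matrix.one_mul]
  exact (IsIdempotentElem.one_sub this)

/-- If `B * A = 1`, then `1 - A * B` projects onto `ker B` along the range of `A`, so its range plus
`R ^ k` is `R ^ n`. Conversely, if `M × N ≅ R ^ n` with `N ≅ R ^ k`, take for `A` and `B` the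
inclusion of and projection to `N`. -/
theorem isHermite_iff : IsHermite R ↔
    ∀ (n k : ℕ) (A : Matrix (Fin n) (Fin k) R) (B : Matrix (Fin k) (Fin n) R), B * A = 1 →
      MatrixSplits (1 - A * B) := by
  constructor
  · intro h n k A B hBA
    have hE := one_sub_mul_idempotent hBA
    refine matrixSplits_of_free_range hE (h _ inferInstance ?_)
    set E := 1 - A * B with hEdef
    have hBE : B * E = 0 := by
      rw [hEdef, Matrix.mul_sub, ← Matrix.mul_assoc, hBA]; simp
    have hEA : E * A = 0 := by
      rw [hEdef, Matrix.sub_mul, Matrix.mul_assoc, hBA]; simp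
    have hEE' (x) : Matrix.toLin' E (Matrix.toLin' E x) = Matrix.toLin' E x := by
      rw [← LinearMap.comp_apply, ← Matrix.toLin'_mul, hE]
    have hBE' (x) : Matrix.toLin' B (Matrix.toLin' E x) = 0 := by
      rw [← LinearMap.comp_apply, ← Matrix.toLin'_mul, hBE]; simp
    have hEA' (x) : Matrix.toLin' E (Matrix.toLin' A x) = 0 := by
      rw [← LinearMap.comp_apply, ← Matrix.toLin'_mul, hEA]; simp
    have hBA' (x) : Matrix.toLin' B (Matrix.toLin' A x) = x := by
      rw [← LinearMap.comp_apply, ← Matrix.toLin'_mul, hBA]; simp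
    have hsum (x) : Matrix.toLin' E x + Matrix.toLin' A (Matrix.toLin' B x) = x := by
      rw [← LinearMap.comp_apply, ← Matrix.toLin'_mul, ← LinearMap.add_apply, ← map_add, hEdef]
      simp
    have : Module.Free R (LinearMap.range (Matrix.toLin' E) × (Fin k → R)) := by
      refine Module.Free.of_equiv (LinearEquiv.ofLinearMap
        ((Matrix.toLin' E).rangeRestrict.prod (Matrix.toLin' B))
        ((Submodule.subtype _).coprod (Matrix.toLin' A)) ?_ ?_)
      · refine LinearMap.ext fun x => ?_
        obtain ⟨⟨_, y, rfl⟩, z⟩ := x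
        refine Prod.ext (Subtype.ext ?_) ?_
        · change Matrix.toLin' E (Matrix.toLin' E y + Matrix.toLin' A z) = Matrix.toLin' E y
          rw [map_add, hEE', hEA', add_zero]
        · change Matrix.toLin' B (Matrix.toLin' E y + Matrix.toLin' A z) = z
          rw [map_add, hBE', hBA', zero_add]
      · exact LinearMap.ext hsum
    exact Module.IsStablyFree.of_free_prod R _ (Fin k → R)
  · intro h M _ _ _ _
    obtain ⟨N, _, _, _, _, _⟩ := Module.IsStablyFree.exist_free_prod R M
    obtain ⟨n, ⟨e⟩⟩ := exists_equiv_fin_of_free (R := R) (M × N)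
    obtain ⟨k, ⟨a⟩⟩ := exists_equiv_fin_of_free (R := R) N
    let A := LinearMap.toMatrix' (e.toLinearMap ∘ₗ LinearMap.inr R M N ∘ₗ a.symm.toLinearMap)
    let B := LinearMap.toMatrix' (a.toLinearMap ∘ₗ LinearMap.snd R M N ∘ₗ e.symm.toLinearMap)
    have hBA : B * A = 1 := by
      simp only [A, B]
      rw [← LinearMap.toMatrix'_comp, ← LinearMap.toMatrix'_id]
      congr 1
      refine LinearMap.ext fun x => ?_
      simp
    refine free_of_matrixSplits (LinearMap.fst R M N ∘ₗ e.symm.toLinearMap)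
      (e.toLinearMap ∘ₗ LinearMap.inl R M N) (LinearMap.ext fun x => by simp) ?_
    convert h n k A B hBA using 1
    simp only [A, B]
    rw [← LinearMap.toMatrix'_comp, ← LinearMap.toMatrix'_id, ← map_sub]
    congr 1
    refine LinearMap.ext fun x => ?_
    simp only [LinearMap.comp_apply, LinearMap.sub_apply, LinearMap.id_apply,
      LinearEquiv.coe_coe, LinearEquiv.symm_apply_apply]
    rw [eq_sub_iff_add_eq, ← map_add]
    simp

end Modules

open Filter Topology unitInterval

/-! ### Comparing idempotents -/

/-- For idempotents `p` and `q`, this element intertwines `q` and `p`; it is `1` if `p = q`. -/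
def idempotentIntertwiner {A : Type*} [Ring A] (p q : A) : A := p * q + (1 - p) * (1 - q)

theorem idempotentIntertwiner_mul {A : Type*} [Ring A] {p q : A} (hp : p * p = p)
    (hq : q * q = q) : idempotentIntertwiner p q * q = p * idempotentIntertwiner p q := by
  have h₁ : idempotentIntertwiner p q * q = p * (q * q) + (1 - p) * (q - q * q) := by
    unfold idempotentIntertwiner; noncomm_ring
  have h₂ : p * idempotentIntertwiner p q = p * p * q + (p - p * p) * (1 - q) := by
    unfold idempotentIntertwiner; noncomm_ring
  rw [h₁, h₂, hp, hq]; simp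

theorem idempotentIntertwiner_self {A : Type*} [Ring A] {p : A} (hp : p * p = p) :
    idempotentIntertwiner p p = 1 := by
  have : idempotentIntertwiner p p = 1 + 2 * (p * p - p) := by
    unfold idempotentIntertwiner; noncomm_ring
  rw [this, hp]; simp

/-- If `e` is a continuous family of paths of idempotent matrices, then its two end points are
conjugate by a continuous family of invertible matrices. No assumption on `X` is needed. -/
theorem exists_intertwiner_of_idempotent_path {X : Type*} [TopologicalSpace X] {n : Type*}
    [Fintype n] [DecidableEq n] (e : X × I → Matrix n n ℂ) (he : Continuous e)
    (hee : ∀ z, e z * e z = e z) :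
    ∃ S : X → Matrix n n ℂ, Continuous S ∧
      ∀ x, (S x).det ≠ 0 ∧ S x * e (x, 0) = e (x, 1) * S x := by
  -- `D` is positive, since the intertwiner is `1` on the diagonal. If `m x` is its minimum over the
  -- square, times less than `m x` apart have an invertible intertwiner.
  let D : X → I × I → ℝ := fun x st => |(st.1 : ℝ) - st.2| +
    ‖(idempotentIntertwiner (e (x, st.1)) (e (x, st.2))).det‖
  have hD : Continuous ↿D := by
    change Continuous fun y : X × I × I => |(y.2.1 : ℝ) - y.2.2| +
      ‖(idempotentIntertwiner (e (y.1, y.2.1)) (e (y.1, y.2.2))).det‖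
    unfold idempotentIntertwiner
    fun_prop
  have hDpos (x st) : 0 < D x st := by
    rcases eq_or_ne st.1 st.2 with h | h
    · have : D x st = 1 := by
        simp only [D]
        rw [h, idempotentIntertwiner_self (hee _)]; simp
      rw [this]; exact one_pos
    · have : 0 < |(st.1 : ℝ) - st.2| := by
        rw [abs_pos, sub_ne_zero]; exact fun h' => h (Subtype.ext h')
      have := norm_nonneg (idempotentIntertwiner (e (x, st.1)) (e (x, st.2))).det
      simp only [D]; linarith
  let m : X → ℝ := fun x => sInf (D x '' Set.univ)
  have hm : Continuous m := isCompact_univ.continuous_sInf hD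
  have hmle (x st) : m x ≤ D x st :=
    csInf_le ⟨0, by rintro _ ⟨y, -, rfl⟩; exact (hDpos x y).le⟩ ⟨st, trivial, rfl⟩
  have hmpos (x) : 0 < m x := by
    have hDx : Continuous (D x) := hD.comp (Continuous.prodMk_right x)
    obtain ⟨st, -, h⟩ := isCompact_univ.exists_sInf_image_eq Set.univ_nonempty hDx.continuousOn
    change 0 < sInf (D x '' Set.univ)
    rw [h]; exact hDpos x st
  -- Steps of length `m x / 2 < m x`, clamped at `1`; the step length varies continuously with `x`,
  -- so no partition of unity is needed.
  let τ : ℕ → X → I := fun k x => Set.projIcc 0 1 zero_le_one (k * (m x / 2))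
  have hτ (k) : Continuous (τ k) := by
    refine continuous_projIcc.comp ?_
    fun_prop
  have hτstep (k x) : |(τ (k + 1) x : ℝ) - τ k x| ≤ m x / 2 := by
    have := Set.abs_projIcc_sub_projIcc (zero_le_one (α := ℝ)) (c := (k + 1 : ℕ) * (m x / 2))
      (d := k * (m x / 2))
    refine this.trans ?_
    have h2 : ((k + 1 : ℕ) : ℝ) * (m x / 2) - k * (m x / 2) = m x / 2 := by push_cast; ring
    rw [h2, abs_of_pos (half_pos (hmpos x))]
  have hτ0 (x) : τ 0 x = 0 := by
    simp only [τ]; rw [Nat.cast_zero, zero_mul]; exact Set.projIcc_left _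
  have hτ1 (k : ℕ) (x) (h : 1 ≤ k * (m x / 2)) : τ k x = 1 := Set.projIcc_of_right_le _ h
  let T : ℕ → X → Matrix n n ℂ := fun k x =>
    idempotentIntertwiner (e (x, τ (k + 1) x)) (e (x, τ k x))
  have hTdet (k x) : (T k x).det ≠ 0 := by
    intro h0
    have h1 := hmle x (τ (k + 1) x, τ k x)
    have h2 : D x (τ (k + 1) x, τ k x) = |(τ (k + 1) x : ℝ) - τ k x| + ‖(T k x).det‖ := rfl
    rw [h2, h0, norm_zero, add_zero] at h1
    linarith [hτstep k x, hmpos x]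
  let S : ℕ → X → Matrix n n ℂ := fun k x => Nat.rec 1 (fun k s => T k x * s) k
  have hS0 (x) : S 0 x = 1 := rfl
  have hSs (k x) : S (k + 1) x = T k x * S k x := rfl
  have hScont (k) : Continuous (S k) := by
    induction k with
    | zero => exact continuous_const
    | succ k ih =>
      have hτk := hτ k
      have hτk' := hτ (k + 1)
      have : Continuous (T k) := by
        simp only [T, idempotentIntertwiner]
        fun_prop
      exact this.mul ih
  have hSdet (k x) : (S k x).det ≠ 0 := by
    induction k with
    | zero => simp [hS0]
    | succ k ih => rw [hSs, Matrix.det_mul]; exact mul_ne_zero (hTdet k x) ih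
  have hSe (k x) : S k x * e (x, 0) = e (x, τ k x) * S k x := by
    induction k with
    | zero => simp [hS0, hτ0]
    | succ k ih =>
      rw [hSs, Matrix.mul_assoc, ih, ← Matrix.mul_assoc,
        idempotentIntertwiner_mul (hee _) (hee _), Matrix.mul_assoc]
  have hstab (x) (k : ℕ) (h : 1 ≤ k * (m x / 2)) (l : ℕ) (hl : k ≤ l) : S l x = S k x := by
    induction l, hl using Nat.le_induction with
    | base => rfl
    | succ l hl ih =>
      have hl' : 1 ≤ l * (m x / 2) :=
        h.trans (mul_le_mul_of_nonneg_right (by exact_mod_cast hl) (half_pos (hmpos x)).le)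
      have hl'' : 1 ≤ (l + 1 : ℕ) * (m x / 2) :=
        hl'.trans (mul_le_mul_of_nonneg_right (by push_cast; linarith) (half_pos (hmpos x)).le)
      rw [hSs, ih]
      have : T l x = 1 := by
        simp only [T]
        rw [hτ1 l x hl', hτ1 (l + 1) x hl'']
        exact idempotentIntertwiner_self (hee _)
      rw [this, Matrix.one_mul]
  have hex (x) : ∃ k : ℕ, 1 < k * (m x / 2) := by
    obtain ⟨k, hk⟩ := exists_nat_gt (1 / (m x / 2))
    exact ⟨k, (div_lt_iff₀ (half_pos (hmpos x))).1 hk⟩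
  -- `N` need not be continuous: once the path has reached `1` all further factors are `1`, so near
  -- `x` the product agrees with the one of fixed length `N x`.
  choose N hN using hex
  refine ⟨fun x => S (N x) x, continuous_iff_continuousAt.2 fun x => ?_, fun x => ⟨hSdet _ _, ?_⟩⟩
  · refine ((hScont (N x)).continuousAt).congr ?_
    have : ∀ᶠ y in 𝓝 x, 1 < N x * (m y / 2) :=
      (continuous_const.mul (hm.div_const 2)).continuousAt.eventually (lt_mem_nhds (hN x))
    filter_upwards [this] with y hy
    rw [← hstab y _ hy.le _ (le_max_left (N x) (N y)),
      ← hstab y _ (hN y).le _ (le_max_right (N x) (N y))]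
  · rw [hSe, hτ1 _ _ (hN x).le]

/-! ### Homotopy invariance -/

/-- Precomposition with a continuous map, as a homomorphism of rings of continuous functions. -/
noncomputable abbrev pullback {X Z : Type*} [TopologicalSpace X] [TopologicalSpace Z] (g : C(X, Z)) :
    C(Z, ℂ) →+* C(X, ℂ) :=
  (ContinuousMap.compRightAlgHom ℂ ℂ g).toRingHom

/-- Evaluation at `x`, as a homomorphism from the ring of continuous functions. -/
noncomputable abbrev evalAt {X : Type*} [TopologicalSpace X] (x : X) : C(X, ℂ) →+* ℂ :=
  (ContinuousMap.evalAlgHom ℂ ℂ x).toRingHom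

theorem MatrixSplits.of_homotopic {X Z : Type*} [TopologicalSpace X] [TopologicalSpace Z]
    {g₀ g₁ : C(X, Z)} (H : g₀.Homotopic g₁) {n : ℕ} {E : Matrix (Fin n) (Fin n) C(Z, ℂ)}
    (hE : E * E = E) (h : MatrixSplits (E.map (pullback g₀))) :
    MatrixSplits (E.map (pullback g₁)) := by
  obtain ⟨H⟩ := H
  let e : X × I → Matrix (Fin n) (Fin n) ℂ := fun z => E.map (evalAt (H (z.2, z.1)))
  have he : Continuous e := by
    refine continuous_matrix fun i j => ?_
    exact (E i j).continuous.comp (H.continuous.comp continuous_swap)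
  have hee (z) : e z * e z = e z := by
    simp only [e]; rw [← Matrix.map_mul, hE]
  obtain ⟨S, hS, hS'⟩ := exists_intertwiner_of_idempotent_path e he hee
  let T : Matrix (Fin n) (Fin n) C(X, ℂ) :=
    Matrix.of fun i j => ⟨fun x => S x i j, hS.matrix_elem i j⟩
  have hT (x) : T.map (evalAt x) = S x := by ext i j; rfl
  refine h.of_intertwine (T := T) ?_ ?_
  · rw [ContinuousMap.isUnit_iff_forall_ne_zero]
    intro x
    have : T.det x = (T.map (evalAt x)).det := RingHom.map_det (evalAt x) T
    rw [this, hT]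
    exact (hS' x).1
  · have key (x) : (T * E.map (pullback g₀)).map (evalAt x) =
        (E.map (pullback g₁) * T).map (evalAt x) := by
      have h0 : (E.map (pullback g₀)).map (evalAt x) = e (x, 0) := by
        ext i j
        simp [e]
      have h1 : (E.map (pullback g₁)).map (evalAt x) = e (x, 1) := by
        ext i j
        simp [e]
      rw [Matrix.map_mul, Matrix.map_mul, hT, h0, h1]
      exact (hS' x).2
    ext i j x
    exact congrFun (congrFun (key x) i) j

/-- Pulled back to `Z` and then to `X`, the matrix splits, and the round trip is homotopic to the
identity of `X`. Only this half of the equivalence matters. -/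
theorem IsProjectiveFree.of_homotopyEquiv {X Z : Type*} [TopologicalSpace X] [TopologicalSpace Z]
    (h : ContinuousMap.HomotopyEquiv X Z) (hZ : IsProjectiveFree C(Z, ℂ)) :
    IsProjectiveFree C(X, ℂ) := by
  rw [isProjectiveFree_iff] at hZ ⊢
  intro n E hE
  have h₁ : MatrixSplits (E.map (pullback h.invFun)) :=
    hZ n _ (by rw [← Matrix.map_mul, hE])
  have h₂ : MatrixSplits (E.map (pullback (h.invFun.comp h.toFun))) :=
    h₁.map (pullback h.toFun)
  exact h₂.of_homotopic h.left_inv hE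

theorem IsHermite.of_homotopyEquiv {X Z : Type*} [TopologicalSpace X] [TopologicalSpace Z]
    (h : ContinuousMap.HomotopyEquiv X Z) (hZ : IsHermite C(Z, ℂ)) : IsHermite C(X, ℂ) := by
  rw [isHermite_iff] at hZ ⊢
  intro n k A B hBA
  have h₀ := hZ n k (A.map (pullback h.invFun)) (B.map (pullback h.invFun))
    (by rw [← Matrix.map_mul, hBA, Matrix.map_one _ (map_zero _) (map_one _)])
  have h₁ : MatrixSplits ((1 - A * B).map (pullback h.invFun)) := by
    rwa [Matrix.map_sub _ (map_sub _), Matrix.map_mul, Matrix.map_one _ (map_zero _) (map_one _)]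
  have h₂ : MatrixSplits ((1 - A * B).map (pullback (h.invFun.comp h.toFun))) :=
    h₁.map (pullback h.toFun)
  exact h₂.of_homotopic h.left_inv (one_sub_mul_idempotent hBA)

/-! ### Almost idempotent elements of Banach algebras -/

/-- An almost idempotent element of a complete normed ring is close to an idempotent: iterate
`x ↦ 3 x ^ 2 - 2 x ^ 3`. -/
theorem exists_idempotent_near {A : Type*} [NormedRing A] [CompleteSpace A] (x : A)
    (hx : ‖x * x - x‖ ≤ 1 / 32) :
    ∃ e : A, e * e = e ∧ ‖e - x‖ ≤ 2 * (‖2 * x - 1‖ * ‖x * x - x‖) := by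
  let p : A → A := fun x => x - (2 * x - 1) * (x * x - x)
  let s : ℕ → A := fun k => p^[k] x
  have hs (k) : s (k + 1) = p (s k) := Function.iterate_succ_apply' p k x
  have hu (y : A) (hy : ‖y * y - y‖ ≤ 1 / 32) : ‖p y * p y - p y‖ ≤ ‖y * y - y‖ / 8 := by
    -- With `u = y ^ 2 - y` the new defect is `4 u ^ 3 - 3 u ^ 2`; the bound `1 / 32` on `‖u‖` makes
    -- it at most `‖u‖ / 8`.
    have h1 : p y * p y - p y = (y * y - y) * (y * y - y) *
        ((y * y - y) + (y * y - y) + (y * y - y) + (y * y - y)) -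
        ((y * y - y) * (y * y - y) + (y * y - y) * (y * y - y) + (y * y - y) * (y * y - y)) := by
      simp only [p]; noncomm_ring
    rw [h1]
    set u := y * y - y
    have a1 : ‖u * u‖ ≤ ‖u‖ * ‖u‖ := norm_mul_le _ _
    have a2 : ‖u + u + u + u‖ ≤ ‖u‖ + ‖u‖ + ‖u‖ + ‖u‖ := norm_add₄_le
    have a3 : ‖u * u + u * u + u * u‖ ≤ ‖u * u‖ + ‖u * u‖ + ‖u * u‖ := norm_add₃_le
    have a4 : ‖u * u * (u + u + u + u)‖ ≤ ‖u‖ * ‖u‖ * (‖u‖ + ‖u‖ + ‖u‖ + ‖u‖) :=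
      (norm_mul_le _ _).trans (mul_le_mul a1 a2 (norm_nonneg _) (by positivity))
    have a5 := norm_sub_le (u * u * (u + u + u + u)) (u * u + u * u + u * u)
    have hu0 := norm_nonneg u
    have a6 : ‖u‖ * ‖u‖ ≤ ‖u‖ * (1 / 32) := mul_le_mul_of_nonneg_left hy hu0
    have a7 : ‖u‖ * ‖u‖ * (‖u‖ + ‖u‖ + ‖u‖ + ‖u‖) ≤ ‖u‖ * (1 / 32) * (4 * (1 / 32)) :=
      mul_le_mul a6 (by linarith) (by positivity) (by positivity)
    linarith
  have hv (y : A) (hy : ‖y * y - y‖ ≤ 1 / 32) : ‖2 * p y - 1‖ ≤ 2 * ‖2 * y - 1‖ := by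
    have h1 : 2 * p y - 1 = (2 * y - 1) - ((2 * y - 1) * (y * y - y) +
        (2 * y - 1) * (y * y - y)) := by
      simp only [p]; noncomm_ring
    rw [h1]
    have a1 : ‖(2 * y - 1) * (y * y - y)‖ ≤ ‖2 * y - 1‖ * (1 / 32) :=
      (norm_mul_le _ _).trans (mul_le_mul_of_nonneg_left hy (norm_nonneg _))
    have a2 := norm_sub_le (2 * y - 1) ((2 * y - 1) * (y * y - y) + (2 * y - 1) * (y * y - y))
    have a3 := norm_add_le ((2 * y - 1) * (y * y - y)) ((2 * y - 1) * (y * y - y))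
    linarith [norm_nonneg (2 * y - 1)]
  have hus (k) : ‖s k * s k - s k‖ ≤ ‖x * x - x‖ * (1 / 8) ^ k := by
    induction k with
    | zero => simp [s]
    | succ k ih =>
      have : ‖x * x - x‖ * (1 / 8) ^ k ≤ 1 / 32 :=
        (mul_le_of_le_one_right (norm_nonneg _) (pow_le_one₀ (by norm_num) (by norm_num))).trans hx
      rw [hs]
      refine (hu _ (ih.trans this)).trans ?_
      rw [pow_succ]
      linarith
  have hus' (k) : ‖s k * s k - s k‖ ≤ 1 / 32 :=
    (hus k).trans
      ((mul_le_of_le_one_right (norm_nonneg _) (pow_le_one₀ (by norm_num) (by norm_num))).trans hx)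
  have hvs (k) : ‖2 * s k - 1‖ ≤ ‖2 * x - 1‖ * 2 ^ k := by
    induction k with
    | zero => simp [s]
    | succ k ih =>
      rw [hs]
      refine (hv _ (hus' k)).trans ?_
      rw [pow_succ]
      linarith
  -- The defect shrinks by `1 / 8` while `2 * s k - 1` at most doubles, whence the ratio `1 / 4`.
  have hdist (k) : dist (s k) (s (k + 1)) ≤ ‖2 * x - 1‖ * ‖x * x - x‖ * (1 / 4) ^ k := by
    rw [hs, dist_eq_norm]
    have h1 : s k - p (s k) = (2 * s k - 1) * (s k * s k - s k) := by simp only [p]; abel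
    rw [h1]
    refine (norm_mul_le _ _).trans ?_
    refine (mul_le_mul (hvs k) (hus k) (norm_nonneg _) (by positivity)).trans_eq ?_
    have : (1 / 4 : ℝ) ^ k = 2 ^ k * (1 / 8) ^ k := by rw [← mul_pow]; norm_num
    rw [this]; ring
  obtain ⟨e, he⟩ := cauchySeq_tendsto_of_complete
    (cauchySeq_of_le_geometric (1 / 4) _ (by norm_num) hdist)
  refine ⟨e, ?_, ?_⟩
  · have h1 : Tendsto (fun k => s k * s k - s k) atTop (𝓝 (e * e - e)) := (he.mul he).sub he
    have h2 : Tendsto (fun k => s k * s k - s k) atTop (𝓝 0) := by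
      refine squeeze_zero_norm hus ?_
      have := (tendsto_pow_atTop_nhds_zero_of_lt_one (r := (1 / 8 : ℝ)) (by norm_num)
        (by norm_num)).const_mul ‖x * x - x‖
      simpa using this
    exact sub_eq_zero.1 (tendsto_nhds_unique h1 h2)
  · have h1 := dist_le_of_le_geometric_of_tendsto₀ (1 / 4) _ (by norm_num) hdist he
    have h2 : dist (s 0) e = ‖e - x‖ := by rw [dist_comm, dist_eq_norm]; rfl
    rw [h2] at h1
    refine h1.trans ?_
    have : 0 ≤ ‖2 * x - 1‖ * ‖x * x - x‖ := by positivity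
    rw [div_le_iff₀ (by norm_num)]
    linarith

/-! ### Matrices of continuous functions with the operator norm -/

section MatrixNorm

open scoped Matrix.Norms.Operator

theorem Matrix.linfty_opNorm_le_of_entries {n : Type*} [Fintype n] {α : Type*}
    [NormedAddCommGroup α] (H : Matrix n n α) {c : ℝ} (hc : 0 ≤ c) (h : ∀ k l, ‖H k l‖ ≤ c) :
    ‖H‖ ≤ Fintype.card n * c := by
  lift c to NNReal using hc
  rw [Matrix.linfty_opNorm_def]
  have : (Finset.univ.sup fun i => ∑ j, ‖H i j‖₊) ≤ Fintype.card n * c := by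
    refine Finset.sup_le fun i _ => ?_
    refine (Finset.sum_le_card_nsmul _ _ c fun j _ => h i j).trans ?_
    simp
  exact_mod_cast this

theorem Matrix.completeSpace_linftyOp {n : Type*} [Fintype n] {α : Type*}
    [NormedAddCommGroup α] [CompleteSpace α] : CompleteSpace (Matrix n n α) :=
  inferInstanceAs (CompleteSpace (n → n → α))

theorem norm_map_pullback_le {X Z : Type*} [TopologicalSpace X] [TopologicalSpace Z]
    [CompactSpace X] [CompactSpace Z] (g : C(X, Z)) {n : Type*} [Fintype n]
    (H : Matrix n n C(Z, ℂ)) : ‖H.map (pullback g)‖ ≤ ‖H‖ := by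
  rw [Matrix.linfty_opNorm_def, Matrix.linfty_opNorm_def, NNReal.coe_le_coe]
  refine Finset.sup_mono_fun fun i _ => Finset.sum_le_sum fun j _ => ?_
  change ‖(H i j).comp g‖ ≤ ‖H i j‖
  exact (ContinuousMap.norm_le _ (norm_nonneg _)).2 fun x => (H i j).norm_coe_le_norm _

/-- At `G = E` the intertwiner is `1`, and units are open in the Banach algebra `C(Z, ℂ)`. -/
theorem exists_isUnit_det_intertwiner {Z : Type*} [TopologicalSpace Z]
    [CompactSpace Z] {n : ℕ} {E : Matrix (Fin n) (Fin n) C(Z, ℂ)} (hE : E * E = E) :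
    ∃ ε > 0, ∀ G : Matrix (Fin n) (Fin n) C(Z, ℂ), ‖G - E‖ < ε →
      IsUnit (idempotentIntertwiner E G).det := by
  have h1 : Continuous fun G : Matrix (Fin n) (Fin n) C(Z, ℂ) =>
      (idempotentIntertwiner E G).det := by
    unfold idempotentIntertwiner
    fun_prop
  have h2 : {G : Matrix (Fin n) (Fin n) C(Z, ℂ) | IsUnit (idempotentIntertwiner E G).det} ∈ 𝓝 E :=
    (Units.isOpen.preimage h1).mem_nhds (by simp [idempotentIntertwiner_self hE])
  obtain ⟨ε, hε, h⟩ := Metric.mem_nhds_iff.1 h2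
  exact ⟨ε, hε, fun G hG => h (by rwa [Metric.mem_ball, dist_eq_norm])⟩

end MatrixNorm

/-! ### Projective limits of compact spaces -/

namespace ProjLim

variable {ι : Type*} [Preorder ι] {Y : ι → Type*} [∀ i, TopologicalSpace (Y i)]
  {f : ∀ ⦃i j : ι⦄, i ≤ j → C(Y j, Y i)}

/-- The projection of a projective limit to one of its terms. -/
def proj (f : ∀ ⦃i j : ι⦄, i ≤ j → C(Y j, Y i)) (i : ι) : C(ProjLim f, Y i) :=
  ⟨fun z => z.1 i, (continuous_apply i).comp continuous_subtype_val⟩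

theorem comp_proj {i j : ι} (h : i ≤ j) : (f h).comp (proj f j) = proj f i :=
  ContinuousMap.ext fun z => z.2 h

theorem map_map_proj {m n : Type*} {i j : ι} (h : i ≤ j) (F : Matrix m n C(Y i, ℂ)) :
    (F.map (pullback (f h))).map (pullback (proj f j)) = F.map (pullback (proj f i)) := by
  rw [← comp_proj h]; rfl

instance compactSpace [∀ i, CompactSpace (Y i)] [∀ i, T2Space (Y i)] :
    CompactSpace (ProjLim f) := by
  have : IsClosed {y : ∀ i, Y i | ∀ ⦃i j : ι⦄ (h : i ≤ j), f h (y j) = y i} := ?_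
  · exact this.isClosedEmbedding_subtypeVal.compactSpace
  simp only [Set.ofPred_forall]
  refine isClosed_iInter fun i => isClosed_iInter fun j => isClosed_iInter fun h => ?_
  exact isClosed_eq ((f h).continuous.comp (continuous_apply j)) (continuous_apply i)

variable [IsDirectedOrder ι] [∀ i, CompactSpace (Y i)] [∀ i, T2Space (Y i)]

/-- A neighbourhood of the image of the limit in `Y i` contains the image of some `Y j`. -/
theorem exists_forall_mem_of_isOpen [∀ i, Nonempty (Y i)]
    [InverseSystem fun ⦃i j : ι⦄ (h : i ≤ j) ↦ ⇑(f h)]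
    {i : ι} {V : Set (Y i)} (hV : IsOpen V) (hZ : ∀ z : ProjLim f, proj f i z ∈ V) :
    ∃ (j : ι) (h : i ≤ j), ∀ y, f h y ∈ V := by
  have hself (j) (y : Y j) : f le_rfl y = y :=
    InverseSystem.map_self (f := fun ⦃i j : ι⦄ (h : i ≤ j) ↦ ⇑(f h)) y
  have hcomp {k j l : ι} (hkj : k ≤ j) (hjl : j ≤ l) (y : Y l) :
      f hkj (f hjl y) = f (hkj.trans hjl) y :=
    InverseSystem.map_map (f := fun ⦃i j : ι⦄ (h : i ≤ j) ↦ ⇑(f h)) hkj hjl y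
  by_contra! hcon
  -- Families compatible only below `j`, with `i`-th coordinate outside `V`. A bad point of `Y j`
  -- gives one, the other coordinates being arbitrary; a common point of all `t j` would be a point
  -- of the limit outside `V`.
  let t : {j // i ≤ j} → Set (∀ i, Y i) := fun j =>
    {p | p i ∉ V} ∩ {p | ∀ k (h : k ≤ j.1), f h (p j) = p k}
  have htcl (j) : IsClosed (t j) := by
    refine (hV.isClosed_compl.preimage (continuous_apply i)).inter ?_
    simp only [Set.ofPred_forall]
    refine isClosed_iInter fun k => isClosed_iInter fun h => ?_
    exact isClosed_eq ((f h).continuous.comp (continuous_apply _)) (continuous_apply k)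
  have hmono {j l : {j // i ≤ j}} (hjl : j.1 ≤ l.1) : t l ⊆ t j := by
    rintro p ⟨hp₁, hp₂⟩
    refine ⟨hp₁, fun k h => ?_⟩
    rw [← hp₂ j.1 hjl, hcomp, hp₂]
  have htd : Directed (· ⊇ ·) t := by
    intro j l
    obtain ⟨k, hjk, hlk⟩ := exists_ge_ge j.1 l.1
    exact ⟨⟨k, j.2.trans hjk⟩, hmono hjk, hmono hlk⟩
  have htn (j) : (t j).Nonempty := by
    classical
    obtain ⟨y, hy⟩ := hcon j.1 j.2
    refine ⟨fun k => if h : k ≤ j.1 then f h y else Classical.arbitrary _, ?_, fun k h => ?_⟩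
    · simpa [j.2] using hy
    · simp [h, hself]
  have : Nonempty {j // i ≤ j} := ⟨⟨i, le_rfl⟩⟩
  obtain ⟨p, hp⟩ := IsCompact.nonempty_iInter_of_directed_nonempty_isCompact_isClosed t htd htn
    (fun j => (htcl j).isCompact) htcl
  rw [Set.mem_iInter] at hp
  refine (hp ⟨i, le_rfl⟩).1 (hZ ⟨p, fun k l h => ?_⟩)
  obtain ⟨j, hlj, hij⟩ := exists_ge_ge l i
  have h₁ := (hp ⟨j, hij⟩).2 l hlj
  have h₂ := (hp ⟨j, hij⟩).2 k (h.trans hlj)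
  rw [← h₁, hcomp, h₂]

/-- The functions on the limit that factor through one of the projections. -/
def cylinderFunctions (f : ∀ ⦃i j : ι⦄, i ≤ j → C(Y j, Y i)) [Nonempty ι] :
    StarSubalgebra ℂ C(ProjLim f, ℂ) where
  carrier := {g | ∃ (i : ι) (h : C(Y i, ℂ)), pullback (proj f i) h = g}
  mul_mem' := by
    rintro _ _ ⟨i, g, rfl⟩ ⟨j, h, rfl⟩
    obtain ⟨k, hik, hjk⟩ := exists_ge_ge i j
    refine ⟨k, pullback (f hik) g * pullback (f hjk) h, ?_⟩
    rw [map_mul, ← comp_proj hik, ← comp_proj hjk]; rfl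
  add_mem' := by
    rintro _ _ ⟨i, g, rfl⟩ ⟨j, h, rfl⟩
    obtain ⟨k, hik, hjk⟩ := exists_ge_ge i j
    refine ⟨k, pullback (f hik) g + pullback (f hjk) h, ?_⟩
    rw [map_add, ← comp_proj hik, ← comp_proj hjk]; rfl
  algebraMap_mem' c := ⟨Classical.arbitrary ι, algebraMap ℂ _ c, rfl⟩
  star_mem' := by
    rintro _ ⟨i, g, rfl⟩
    exact ⟨i, star g, rfl⟩

/-- Stone–Weierstrass: distinct points of the limit differ in some coordinate, where Urysohn's lemma
separates them. -/
theorem dense_cylinderFunctions [Nonempty ι] :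
    Dense (cylinderFunctions f : Set C(ProjLim f, ℂ)) := by
  have h := ContinuousMap.starSubalgebra_topologicalClosure_eq_top_of_separatesPoints
    (cylinderFunctions f) ?_
  · rw [dense_iff_closure_eq, ← StarSubalgebra.topologicalClosure_coe, h]; rfl
  · intro z w hzw
    obtain ⟨i, hi⟩ : ∃ i, z.1 i ≠ w.1 i := by
      by_contra! h
      exact hzw (Subtype.ext (funext h))
    obtain ⟨g, hg₀, hg₁, -⟩ := exists_continuous_zero_one_of_isClosed
      (isClosed_singleton (x := z.1 i)) (isClosed_singleton (x := w.1 i))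
      (Set.disjoint_singleton.2 hi)
    refine ⟨_, ⟨_, ⟨i, (⟨Complex.ofReal, Complex.continuous_ofReal⟩ : C(ℝ, ℂ)).comp g, rfl⟩,
      rfl⟩, ?_⟩
    have h₀ : g (z.1 i) = 0 := hg₀ rfl
    have h₁ : g (w.1 i) = 1 := hg₁ rfl
    change ((g (z.1 i) : ℝ) : ℂ) ≠ ((g (w.1 i) : ℝ) : ℂ)
    rw [h₀, h₁]; simp

/-- Matrices of continuous functions on the limit are approximated by matrices of continuous
functions on the terms. -/
theorem exists_matrix_map_mem [Nonempty ι] {m n : Type*} [Finite m] [Finite n]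
    {G : Matrix m n C(ProjLim f, ℂ)} {U : Set (Matrix m n C(ProjLim f, ℂ))} (hU : U ∈ 𝓝 G) :
    ∃ (i : ι) (F : Matrix m n C(Y i, ℂ)), F.map (pullback (proj f i)) ∈ U := by
  have hd : Dense (Set.pi Set.univ fun _ : m => Set.pi Set.univ fun _ : n =>
      (cylinderFunctions f : Set C(ProjLim f, ℂ))) :=
    dense_pi _ fun _ _ => dense_pi _ fun _ _ => dense_cylinderFunctions
  obtain ⟨H, hH, hHU⟩ := hd.inter_nhds_nonempty hU
  have hH' (kl : m × n) : ∃ (i : ι) (h : C(Y i, ℂ)), pullback (proj f i) h = H kl.1 kl.2 :=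
    hH kl.1 trivial kl.2 trivial
  choose i h hh using hH'
  obtain ⟨M, hM⟩ := Finite.exists_le i
  refine ⟨M, Matrix.of fun k l => pullback (f (hM (k, l))) (h (k, l)), ?_⟩
  have : (Matrix.of fun k l => pullback (f (hM (k, l))) (h (k, l))).map (pullback (proj f M)) =
      H := by
    refine Matrix.ext fun k l => ?_
    rw [← hh (k, l), ← comp_proj (hM (k, l))]; rfl
  rwa [this]

end ProjLim

/-! ### Hermite rings -/

/-- Two stably free modules `ker B` and `ker B'` are isomorphic as soon as `B * A'` is invertible,
where `A'` is a section of `B'`. -/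
theorem MatrixSplits.one_sub_mul_of_isUnit {R : Type*} [CommRing R] {n k : ℕ}
    {A A' : Matrix (Fin n) (Fin k) R} {B B' : Matrix (Fin k) (Fin n) R} (hBA : B * A = 1)
    (hBA' : B' * A' = 1) (hu : IsUnit (B * A').det) (h : MatrixSplits (1 - A' * B')) :
    MatrixSplits (1 - A * B) := by
  obtain ⟨r, C, D, hCD, hDC⟩ := h
  let W := (B * A')⁻¹
  -- `P` projects onto `ker B` along the range of `A'`, while `1 - A' * B'` projects onto `ker B'`
  -- along the same range: both kernels are complements of it, hence isomorphic.
  let P := 1 - A' * W * B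
  have hBE : B * (1 - A * B) = 0 := by
    rw [Matrix.mul_sub, ← Matrix.mul_assoc, hBA, Matrix.one_mul, Matrix.mul_one, sub_self]
  have hPA' : P * A' = 0 := by
    simp only [P, W]
    rw [Matrix.sub_mul, Matrix.mul_assoc, Matrix.mul_assoc, Matrix.nonsing_inv_mul _ hu,
      Matrix.one_mul, Matrix.mul_one, sub_self]
  have hBP : B * P = 0 := by
    simp only [P, W]
    rw [Matrix.mul_sub, ← Matrix.mul_assoc, ← Matrix.mul_assoc, Matrix.mul_nonsing_inv _ hu,
      Matrix.one_mul, Matrix.mul_one, sub_self]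
  have hDA' : D * A' = 0 := by
    calc D * A' = D * C * D * A' := by rw [hDC, Matrix.one_mul]
      _ = D * ((C * D) * A') := by simp only [Matrix.mul_assoc]
      _ = 0 := by
        rw [hCD, Matrix.sub_mul, Matrix.mul_assoc, hBA', Matrix.one_mul, Matrix.mul_one, sub_self,
          Matrix.mul_zero]
  refine ⟨r, P * C, D * (1 - A * B), ?_, ?_⟩
  · calc P * C * (D * (1 - A * B)) = P * (C * D) * (1 - A * B) := by
          simp only [Matrix.mul_assoc]
      _ = P * (1 - A * B) := by
        rw [hCD, Matrix.mul_sub P, ← Matrix.mul_assoc P, hPA', Matrix.zero_mul, sub_zero,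
          Matrix.mul_one]
      _ = 1 - A * B := by
        simp only [P]
        rw [Matrix.sub_mul 1, Matrix.mul_assoc, hBE, Matrix.mul_zero, sub_zero, Matrix.one_mul]
  · calc D * (1 - A * B) * (P * C) = D * ((1 - A * B) * P) * C := by
          simp only [Matrix.mul_assoc]
      _ = D * P * C := by
        rw [Matrix.sub_mul 1, Matrix.mul_assoc A, hBP, Matrix.mul_zero, sub_zero, Matrix.one_mul]
      _ = D * C := by
        simp only [P]
        rw [Matrix.mul_sub, ← Matrix.mul_assoc, ← Matrix.mul_assoc, hDA', Matrix.zero_mul,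
          Matrix.zero_mul, sub_zero, Matrix.mul_one]
      _ = 1 := hDC

/-! ### Both properties pass to the limit -/

namespace ProjLim

variable {ι : Type*} [Preorder ι] [IsDirectedOrder ι] [Nonempty ι] {Y : ι → Type*}
  [∀ i, TopologicalSpace (Y i)] [∀ i, CompactSpace (Y i)] [∀ i, T2Space (Y i)]
  [∀ i, Nonempty (Y i)] (f : ∀ ⦃i j : ι⦄, i ≤ j → C(Y j, Y i))
  [InverseSystem fun ⦃i j : ι⦄ (h : i ≤ j) ↦ ⇑(f h)]

theorem isHermite (h : ∀ i, IsHermite C(Y i, ℂ)) : IsHermite C(ProjLim f, ℂ) := by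
  rw [isHermite_iff]
  intro n k A B hBA
  obtain ⟨i₁, A₁, hA₁⟩ : ∃ (i : ι) (F : Matrix (Fin n) (Fin k) C(Y i, ℂ)),
      F.map (pullback (proj f i)) ∈ {G | IsUnit (B * G).det} := by
    refine exists_matrix_map_mem (G := A) ?_
    have h1 : Continuous fun G : Matrix (Fin n) (Fin k) C(ProjLim f, ℂ) => (B * G).det := by
      fun_prop
    exact (Units.isOpen.preimage h1).mem_nhds (by simp [hBA])
  -- `B₂` serves only to make the approximation of `A` left invertible on some `Y j`; the comparison
  -- with `B` uses `hA₁` alone.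
  obtain ⟨i₂, B₂, hB₂⟩ : ∃ (i : ι) (F : Matrix (Fin k) (Fin n) C(Y i, ℂ)),
      F.map (pullback (proj f i)) ∈ {G | IsUnit (G * A₁.map (pullback (proj f i₁))).det} := by
    refine exists_matrix_map_mem (G := B) ?_
    have h1 : Continuous fun G : Matrix (Fin k) (Fin n) C(ProjLim f, ℂ) =>
      (G * A₁.map (pullback (proj f i₁))).det := by fun_prop
    exact (Units.isOpen.preimage h1).mem_nhds hA₁
  obtain ⟨i, h₁, h₂⟩ := exists_ge_ge i₁ i₂
  rw [Set.mem_ofPred_eq] at hA₁ hB₂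
  rw [← map_map_proj h₁] at hA₁ hB₂
  rw [← map_map_proj h₂] at hB₂
  generalize A₁.map (pullback (f h₁)) = A' at hA₁ hB₂
  generalize B₂.map (pullback (f h₂)) = B' at hB₂
  obtain ⟨j, hij, hj⟩ : ∃ (j : ι) (h : i ≤ j), ∀ y, f h y ∈ {y | (B' * A').det y ≠ 0} := by
    refine exists_forall_mem_of_isOpen
      (isOpen_ne_fun (B' * A').det.continuous continuous_const) fun z => ?_
    rw [← Matrix.map_mul] at hB₂
    have hdet : ((B' * A').map (pullback (proj f i))).det = pullback (proj f i) (B' * A').det :=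
      (RingHom.map_det (pullback (proj f i)) (B' * A')).symm
    rw [hdet, ContinuousMap.isUnit_iff_forall_ne_zero] at hB₂
    exact hB₂ z
  rw [← map_map_proj hij] at hA₁
  have hu : IsUnit (B'.map (pullback (f hij)) * A'.map (pullback (f hij))).det := by
    have hdet : ((B' * A').map (pullback (f hij))).det = pullback (f hij) (B' * A').det :=
      (RingHom.map_det (pullback (f hij)) (B' * A')).symm
    rw [← Matrix.map_mul, hdet, ContinuousMap.isUnit_iff_forall_ne_zero]
    exact hj
  generalize A'.map (pullback (f hij)) = A'' at hA₁ hu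
  generalize B'.map (pullback (f hij)) = B'' at hu
  have hone : (B'' * A'')⁻¹ * B'' * A'' = 1 := by
    rw [Matrix.mul_assoc, Matrix.nonsing_inv_mul _ hu]
  have hs := (isHermite_iff.1 (h j) n k A'' ((B'' * A'')⁻¹ * B'') hone).map (pullback (proj f j))
  rw [Matrix.map_sub _ (map_sub _), Matrix.map_mul, Matrix.map_one _ (map_zero _) (map_one _)] at hs
  refine MatrixSplits.one_sub_mul_of_isUnit hBA ?_ hA₁ hs
  rw [← Matrix.map_mul, hone, Matrix.map_one _ (map_zero _) (map_one _)]

open scoped Matrix.Norms.Operator in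
theorem isProjectiveFree (h : ∀ i, IsProjectiveFree C(Y i, ℂ)) :
    IsProjectiveFree C(ProjLim f, ℂ) := by
  rw [isProjectiveFree_iff]
  intro n E hE
  obtain ⟨ε, hε, hEε⟩ := exists_isUnit_det_intertwiner hE
  obtain ⟨K, hK0, hK⟩ : ∃ K : ℝ, 0 < K ∧ ∀ k l, ‖(2 * E - 1 : Matrix (Fin n) (Fin n) _) k l‖ < K := by
    obtain ⟨K, hK⟩ := Finite.exists_le fun kl : Fin n × Fin n => ‖(2 * E - 1 : Matrix (Fin n) (Fin n) _) kl.1 kl.2‖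
    refine ⟨max K 0 + 1, by positivity, fun k l => ?_⟩
    have := hK (k, l)
    have := le_max_left K 0
    simp only at *
    linarith
  -- Entrywise bounds `K` and `δ` give operator norms at most `n * K` and `n * δ`. The two
  -- conditions allow `exists_idempotent_near` and keep its correction below `ε / 2`.
  obtain ⟨δ, hδ0, hδ₁, hδ₂⟩ : ∃ δ : ℝ, 0 < δ ∧ n * δ ≤ 1 / 32 ∧
      2 * (n * K * (n * δ)) < ε / 2 := by
    have h1 : Tendsto (fun δ : ℝ => n * δ) (𝓝[>] 0) (𝓝 0) := by
      have : Continuous fun δ : ℝ => n * δ := by fun_prop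
      exact (this.tendsto' 0 0 (by simp)).mono_left nhdsWithin_le_nhds
    have h2 : Tendsto (fun δ : ℝ => 2 * (n * K * (n * δ))) (𝓝[>] 0) (𝓝 0) := by
      have : Continuous fun δ : ℝ => 2 * (n * K * (n * δ)) := by fun_prop
      exact (this.tendsto' 0 0 (by simp)).mono_left nhdsWithin_le_nhds
    obtain ⟨δ, hδ, hδ₁, hδ₂⟩ := (eventually_mem_nhdsWithin.and
      ((h1.eventually (ge_mem_nhds (show (0 : ℝ) < 1 / 32 by norm_num))).and
        (h2.eventually (gt_mem_nhds (half_pos hε))))).exists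
    exact ⟨δ, hδ, hδ₁, hδ₂⟩
  obtain ⟨i, F, hF⟩ : ∃ (i : ι) (F : Matrix (Fin n) (Fin n) C(Y i, ℂ)),
      F.map (pullback (proj f i)) ∈ {G | ‖G - E‖ < ε / 2 ∧
        ∀ k l, ‖(2 * G - 1 : Matrix (Fin n) (Fin n) _) k l‖ < K ∧ ‖(G * G - G) k l‖ < δ} := by
    refine exists_matrix_map_mem (G := E) (IsOpen.mem_nhds ?_ ?_)
    · simp only [Set.ofPred_and, Set.ofPred_forall]
      refine IsOpen.inter ?_ (isOpen_iInter_of_finite fun k => isOpen_iInter_of_finite fun l =>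
        IsOpen.inter ?_ ?_)
      · exact isOpen_lt (by fun_prop) continuous_const
      · exact isOpen_lt (Continuous.norm (Continuous.matrix_elem (by fun_prop) k l))
          continuous_const
      · exact isOpen_lt (Continuous.norm (Continuous.matrix_elem (by fun_prop) k l))
          continuous_const
    · refine ⟨by simpa using half_pos hε, fun k l => ⟨hK k l, ?_⟩⟩
      rw [hE, sub_self]
      simpa using hδ0
  obtain ⟨hF₁, hF₂⟩ := hF
  -- The projection to `Y i` need not be surjective, so norms over the limit do not bound norms over
  -- `Y i`.
  obtain ⟨j, hij, hj⟩ : ∃ (j : ι) (h : i ≤ j), ∀ y, f h y ∈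
      {y | ∀ k l, ‖(2 * F - 1 : Matrix (Fin n) (Fin n) C(Y i, ℂ)) k l y‖ < K ∧
        ‖(F * F - F) k l y‖ < δ} := by
    refine exists_forall_mem_of_isOpen ?_ fun z k l => ?_
    · simp only [Set.ofPred_and, Set.ofPred_forall]
      refine isOpen_iInter_of_finite fun k => isOpen_iInter_of_finite fun l => IsOpen.inter ?_ ?_
      · exact isOpen_lt (by fun_prop) continuous_const
      · exact isOpen_lt (by fun_prop) continuous_const
    · obtain ⟨h₁, h₂⟩ := hF₂ k l
      have e₁ : 2 * F.map (pullback (proj f i)) - 1 = (2 * F - 1).map (pullback (proj f i)) := by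
        change _ = (pullback (proj f i)).mapMatrix (2 * F - 1)
        rw [map_sub, map_mul, map_one, map_ofNat]; rfl
      have e₂ : F.map (pullback (proj f i)) * F.map (pullback (proj f i)) -
          F.map (pullback (proj f i)) = (F * F - F).map (pullback (proj f i)) := by
        rw [Matrix.map_sub _ (map_sub _), Matrix.map_mul]
      rw [e₁] at h₁
      rw [e₂] at h₂
      exact ⟨(ContinuousMap.norm_coe_le_norm _ z).trans_lt h₁,
        (ContinuousMap.norm_coe_le_norm _ z).trans_lt h₂⟩
  let F' := F.map (pullback (f hij))
  have hF'₁ : ‖2 * F' - 1‖ ≤ n * K := by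
    have e₁ : 2 * F' - 1 = (2 * F - 1).map (pullback (f hij)) := by
      change _ = (pullback (f hij)).mapMatrix (2 * F - 1)
      rw [map_sub, map_mul, map_one, map_ofNat]; rfl
    have := Matrix.linfty_opNorm_le_of_entries (2 * F' - 1) hK0.le fun k l => by
      rw [e₁]
      exact (ContinuousMap.norm_le _ hK0.le).2 fun y => (hj y k l).1.le
    simpa using this
  have hF'₂ : ‖F' * F' - F'‖ ≤ n * δ := by
    have e₂ : F' * F' - F' = (F * F - F).map (pullback (f hij)) := by
      rw [Matrix.map_sub _ (map_sub _), Matrix.map_mul]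
    have := Matrix.linfty_opNorm_le_of_entries (F' * F' - F') hδ0.le fun k l => by
      rw [e₂]
      exact (ContinuousMap.norm_le _ hδ0.le).2 fun y => (hj y k l).2.le
    simpa using this
  have := Matrix.completeSpace_linftyOp (n := Fin n) (α := C(Y j, ℂ))
  obtain ⟨e, he, heF⟩ := @exists_idempotent_near _ _ this F' (hF'₂.trans hδ₁)
  have hclose : ‖e.map (pullback (proj f j)) - E‖ < ε := by
    have h₁ : ‖e.map (pullback (proj f j)) - F.map (pullback (proj f i))‖ ≤ ‖e - F'‖ := by
      rw [← map_map_proj hij, ← Matrix.map_sub _ (map_sub _)]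
      exact norm_map_pullback_le _ _
    have h₂ : ‖2 * F' - 1‖ * ‖F' * F' - F'‖ ≤ n * K * (n * δ) :=
      mul_le_mul hF'₁ hF'₂ (norm_nonneg _) (by positivity)
    have h₃ := norm_sub_le_norm_sub_add_norm_sub (e.map (pullback (proj f j)))
      (F.map (pullback (proj f i))) E
    linarith
  have hs := (isProjectiveFree_iff.1 (h j) n e he).map (pullback (proj f j))
  exact hs.of_intertwine (hEε _ hclose)
    (idempotentIntertwiner_mul hE (by rw [← Matrix.map_mul, he]))

end ProjLim

/-! ### The empty system, and the main result -/

theorem isProjectiveFree_of_isField {R : Type*} [CommRing R] (h : IsField R) :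
    IsProjectiveFree R := by
  intro M _ _ _ _
  let := h.toField
  exact Module.Free.of_divisionRing R M

theorem IsProjectiveFree.isHermite {R : Type*} [CommRing R] (h : IsProjectiveFree R) :
    IsHermite R := by
  intro M _ _ _ _
  exact h M inferInstance inferInstance

theorem isField_continuousMap_of_unique (Z : Type*) [TopologicalSpace Z] [Unique Z] :
    IsField C(Z, ℂ) := by
  refine ⟨⟨0, 1, zero_ne_one⟩, mul_comm, fun {a} ha => ?_⟩
  have : IsUnit a := by
    rw [ContinuousMap.isUnit_iff_forall_ne_zero]
    intro x hx
    exact ha (ContinuousMap.ext fun y => by rw [Subsingleton.elim y x, hx]; rfl)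
  exact this.exists_right_inv

theorem proposition2p7 {ι : Type*} [Preorder ι] [IsDirectedOrder ι]
    {Y : ι → Type*} [∀ i, TopologicalSpace (Y i)] [∀ i, CompactSpace (Y i)]
    [∀ i, T2Space (Y i)] [∀ i, Nonempty (Y i)]
    (f : ∀ ⦃i j : ι⦄, i ≤ j → C(Y j, Y i)) [InverseSystem fun ⦃i j : ι⦄ (h : i ≤ j) ↦ ⇑(f h)]
    {X : Type*} [TopologicalSpace X]
    (hX : Nonempty (ContinuousMap.HomotopyEquiv X (ProjLim f))) :
    ((∀ i, IsProjectiveFree C(Y i, ℂ)) → IsProjectiveFree C(X, ℂ)) ∧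
      ((∀ i, IsHermite C(Y i, ℂ)) → IsHermite C(X, ℂ)) := by
  obtain ⟨e⟩ := hX
  rcases isEmpty_or_nonempty ι with hι | hι
  -- The limit of the empty system is a point, whose function ring is a field.
  · let : Unique (ProjLim f) :=
      { default := ⟨fun i => isEmptyElim i, fun i => isEmptyElim i⟩
        uniq := fun z => Subtype.ext (funext fun i => isEmptyElim i) }
    have h : IsProjectiveFree C(X, ℂ) := IsProjectiveFree.of_homotopyEquiv e
      (isProjectiveFree_of_isField (isField_continuousMap_of_unique _))
    exact ⟨fun _ => h, fun _ => h.isHermite⟩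
  · exact ⟨fun h => .of_homotopyEquiv e (ProjLim.isProjectiveFree f h),
      fun h => .of_homotopyEquiv e (ProjLim.isHermite f h)⟩
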